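/- **Conventions.** An infinite set $C\subseteq\omega$ is *cohesive* if for every c.e. set $W\subseteq\omega$, $W\cap C$ or $\overline W\cap C$ is finite. Write $C\subseteq^* X$ if $C\setminus X$ is finite. A *computable* structure $\mathcal A=(A,f)$ with one unary function $f:A\to A$ has a computable domain $A\subseteq\omega$ and a computable function $f$. Its *cohesive power* $\Pi_C\mathcal A$ has as domain the set of all partial computable functions $\psi:\omega\to A$ with $C\subseteq^*\mathrm{dom}(\psi)$, modulo the relation $\psi_1=_C\psi_2$ iff $C\subseteq^*\{i:\psi_1(i)\downarrow=\psi_2(i)\downarrow\}$, and its function maps $[\psi]$ to $[f\circ\psi]$. $(A,f)$ is a *$(2,0):1$ structure* if $\mathrm{card}(f^{-1}(a))\in\{0,2\}$ for every $a\in A$. The *orbit* of $a$ is $\{x:(\exists n,m\in\omega)\,f^n(x)=f^m(a)\}$; it is infinite if it is an infinite set. A *$Z$-chain* is an orbit that contains a one-to-one sequence $(s_i)_{i\in\mathbb Z}$ with $f(s_i)=s_{i+1}$ for all $i\in\mathbb Z$ (the other points of the orbit then form binary trees, finite or infinite, attached to the nodes of the sequence). The *length* $l(a)\in\{1,2,\dots\}\cup\{\infty\}$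 of $a$ is $\sup\{n+1: |\{a,f(a),\dots,f^{n}(a)\}|=n+1\}$. The *path character* of $\mathcal A$ is the set of pairs $\langle k,n\rangle$ of positive integers such that at least $n$ elements $a$ have $l(a)=k$; it is *bounded* if there is an upper bound on the first coordinates $k$ of its pairs, and unbounded otherwise. **Theorem.** Let $C$ be a cohesive set and let $\mathcal A$ be a computable $(2,0):1$ structure. (i) If $\mathcal A$ has bounded path character and no infinite orbits, then $\Pi_C\mathcal A\cong\mathcal A$. (ii) If $\mathcal A$ has unbounded path character or an infinite orbit, then $\Pi_C\mathcal A$ has infinitely many $Z$-chains. Hence, if in this case $\mathcal A$ has only finitely many (possibly zero) $Z$-chains, then $\mathcal A\ncong\Pi_C\mathcal A$. -/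

import Mathlib

/-! ### Almost inclusion and cohesive sets -/

/-- `C ⊆* X`: all but finitely many elements of `C` belong to `X`. -/
def AlmostSubset (C X : Set ℕ) : Prop := (C \ X).Finite

/-- A set of natural numbers is cohesive if it is infinite and no c.e. set splits it into two
infinite parts. -/
def IsCohesive (C : Set ℕ) : Prop :=
  C.Infinite ∧ ∀ W : Set ℕ, REPred (fun n => n ∈ W) → (W ∩ C).Finite ∨ (Wᶜ ∩ C).Finite

theorem AlmostSubset.mono {C X Y : Set ℕ} (h : AlmostSubset C X) (hXY : X ⊆ Y) :
    AlmostSubset C Y :=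
  Set.Finite.subset h (Set.sdiff_subset_sdiff_right hXY)

theorem AlmostSubset.inter {C X Y : Set ℕ} (hX : AlmostSubset C X) (hY : AlmostSubset C Y) :
    AlmostSubset C (X ∩ Y) := by
  unfold AlmostSubset at *
  rw [Set.sdiff_inter]
  exact hX.union hY

/-! ### Structures with one unary function -/

section UnaryFunctions

variable {α β : Type*}

/-- `(α, f)` is a `(2,0):1` structure: every point has either no or exactly two preimages. -/
def IsTwoZeroToOne (f : α → α) : Prop :=
  ∀ a, (f ⁻¹' {a}).encard = 0 ∨ (f ⁻¹' {a}).encard = 2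

/-- The orbit of `a`: the connected component of `a` in the directed graph with the edges
`(x, f x)`. -/
def unaryOrbit (f : α → α) (a : α) : Set α := {x | ∃ n m : ℕ, f^[n] x = f^[m] a}

/-- Some orbit is an infinite set. -/
def HasInfiniteOrbit (f : α → α) : Prop := ∃ a, (unaryOrbit f a).Infinite

/-- The length of `a`: the number of points on the longest non-cycling directed path
`a, f a, …, f^n a` that starts with `a`; it may be infinite. -/
noncomputable def pathLength (f : α → α) (a : α) : ℕ∞ :=
  sSup {l : ℕ∞ | ∃ n : ℕ, ((fun i => f^[i] a) '' Set.Iic n).encard = (n : ℕ∞) + 1 ∧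
    l = (n : ℕ∞) + 1}

/-- The path character: the pairs `(k, n)` of positive integers such that at least `n` points
have length `k`. -/
def pathCharacter (f : α → α) : Set (ℕ × ℕ) :=
  {p | 0 < p.1 ∧ 0 < p.2 ∧ (p.2 : ℕ∞) ≤ {a | pathLength f a = (p.1 : ℕ∞)}.encard}

/-- A character is bounded if the first coordinates `k` of its pairs `(k, n)` have an upper
bound. -/
def IsBoundedCharacter (χ : Set (ℕ × ℕ)) : Prop := ∃ K : ℕ, ∀ p ∈ χ, p.1 ≤ K

/-- A `Z`-chain: an orbit with a one-to-one basic sequence, directed by `f` and ordered as the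
integers. (In a `(2,0):1` structure, each node `s i` of the basic sequence then has exactly one
preimage besides `s (i - 1)`, whose iterated preimages form the binary tree attached at `s i`;
every point of the orbit is on the basic sequence or in one of these trees. The trees may be
finite or infinite.) -/
def IsZChain (f : α → α) (O : Set α) : Prop :=
  (∃ a, O = unaryOrbit f a) ∧
    ∃ s : ℤ → α, Function.Injective s ∧ (∀ i, f (s i) = s (i + 1)) ∧ ∀ i, s i ∈ O

/-- The structures `(α, f)` and `(β, g)` are isomorphic. -/
def UnaryIsomorphic (f : α → α) (g : β → β) : Prop :=
  ∃ e : α ≃ β, ∀ x, e (f x) = g (e x)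

end UnaryFunctions

/-! ### Computable structures and cohesive powers -/

/-- A computable structure with a single unary function: its domain is a computable set of
natural numbers, and its function is computable. -/
structure ComputableUnary where
  /-- the domain -/
  carrier : Set ℕ
  /-- the function -/
  map : carrier → carrier
  computable_carrier : ComputablePred (fun n => n ∈ carrier)
  computable_map : ∃ g : ℕ → ℕ, Computable g ∧ ∀ a : carrier, g a = map a

namespace ComputableUnary

variable (A : ComputableUnary) (C : Set ℕ)

/-- The partial computable functions `ψ` from the natural numbers to the domain of `A` with
`C ⊆* dom ψ`. -/
def PowerElem : Type :=
  {ψ : ℕ →. A.carrier //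
    Partrec (fun i => (ψ i).map Subtype.val : ℕ →. ℕ) ∧ AlmostSubset C ψ.Dom}

/-- `ψ₁ =_C ψ₂`: for almost all `i` in `C`, both values at `i` are defined and they are equal. -/
instance powerSetoid : Setoid (A.PowerElem C) where
  r ψ₁ ψ₂ := AlmostSubset C {i | ∃ a, a ∈ ψ₁.1 i ∧ a ∈ ψ₂.1 i}
  iseqv :=
    { refl := fun ψ => ψ.2.2.mono fun i hi => by
        obtain ⟨a, ha⟩ := (PFun.mem_dom _ _).1 hi
        exact ⟨a, ha, ha⟩
      symm := fun h => h.mono fun i hi => by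
        obtain ⟨a, h₁, h₂⟩ := hi
        exact ⟨a, h₂, h₁⟩
      trans := fun h k => (h.inter k).mono fun i hi => by
        obtain ⟨⟨a, h₁, h₂⟩, ⟨b, h₃, h₄⟩⟩ := hi
        obtain rfl := Part.mem_unique h₂ h₃
        exact ⟨a, h₁, h₄⟩ }

/-- The domain of the cohesive power `Π_C A`. -/
def Power : Type := Quotient (A.powerSetoid C)

/-- The representative `i ↦ f (ψ i)` of the value of the function at the class of `ψ`. -/
def powerElemMap (ψ : A.PowerElem C) : A.PowerElem C :=
  ⟨fun i => (ψ.1 i).map A.map, by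
    constructor
    · obtain ⟨g, hg, hgA⟩ := A.computable_map
      have h : Partrec (fun i => ((ψ.1 i).map Subtype.val).map g : ℕ →. ℕ) :=
        ψ.2.1.map (hg.comp Computable.snd).to₂
      refine h.of_eq fun i => ?_
      rw [Part.map_map, Part.map_map]
      congr 1
      funext a
      exact hgA a
    · exact ψ.2.2⟩

/-- The function of the cohesive power `Π_C A`: it sends `[ψ]` to `[i ↦ f (ψ i)]`. -/
def powerMap : A.Power C → A.Power C :=
  Quotient.map (A.powerElemMap C) fun ψ₁ ψ₂ h => by
    refine AlmostSubset.mono (X := {i | ∃ a, a ∈ ψ₁.1 i ∧ a ∈ ψ₂.1 i}) h ?_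
    rintro i ⟨a, h₁, h₂⟩
    exact ⟨A.map a, Part.mem_map _ h₁, Part.mem_map _ h₂⟩

end ComputableUnary

/-! A c.e. property of `i` holds at almost all `i ∈ C` or fails at almost all of them. Hence a
computable search run along representatives either fails almost everywhere or yields an element of
the power (`Power.eventually_or_exists`).

In the bounded case some `n` makes every path repeat within `n` steps, so `f^[n + n!] = f^[n]`. This
identity passes to the power, and all orbits of both structures are finite. A finite orbit of `x` is
copied by evaluation onto the orbit of `x.val i` for almost all `i ∈ C`
(`Power.eventually_orbitIso`). Constants embed the orbits of `A` into those of the power. If an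
isomorphism type has only finitely many orbits in `A`, then an `x` of that type takes values in a
finite set, so it is a constant. Both structures are countable, so the orbits can be matched by
type.

In the other case there are non-repeating paths of every length, and a search gives `x` with at
least `i²` non-repeating steps from `x.val i`. The points `f^[(j+1)i + k] (x.val i)`, for `k ∈ ℤ`,
represent a `Z`-chain for each `j`, and different `j` give different orbits. -/

section UnaryCombinatorics

open Function Set

variable {α β γ : Type*}

/-! ### Orbits and their isomorphisms. -/

theorem mem_unaryOrbit_self (f : α → α) (a : α) : a ∈ unaryOrbit f a := ⟨0, 0, rfl⟩

theorem mem_unaryOrbit_symm {f : α → α} {a b : α} (h : a ∈ unaryOrbit f b) :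
    b ∈ unaryOrbit f a := by
  obtain ⟨n, m, h⟩ := h
  exact ⟨m, n, h.symm⟩

theorem mem_unaryOrbit_trans {f : α → α} {a b c : α} (hab : a ∈ unaryOrbit f b)
    (hbc : b ∈ unaryOrbit f c) : a ∈ unaryOrbit f c := by
  obtain ⟨n, m, h⟩ := hab
  obtain ⟨k, l, h'⟩ := hbc
  refine ⟨k + n, m + l, ?_⟩
  rw [iterate_add_apply, h, ← iterate_add_apply, add_comm k m, iterate_add_apply, h',
    ← iterate_add_apply]

theorem apply_mem_unaryOrbit_self (f : α → α) (a : α) : f a ∈ unaryOrbit f a := ⟨0, 1, rfl⟩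

theorem apply_mem_unaryOrbit {f : α → α} {a b : α} (h : a ∈ unaryOrbit f b) :
    f a ∈ unaryOrbit f b :=
  mem_unaryOrbit_trans (apply_mem_unaryOrbit_self f a) h

theorem mem_unaryOrbit_of_apply {f : α → α} {a b : α} (h : f a ∈ unaryOrbit f b) :
    a ∈ unaryOrbit f b :=
  mem_unaryOrbit_trans (mem_unaryOrbit_symm (apply_mem_unaryOrbit_self f a)) h

theorem iterate_mem_unaryOrbit {f : α → α} {a b : α} (h : a ∈ unaryOrbit f b) (n : ℕ) :
    f^[n] a ∈ unaryOrbit f b :=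
  mem_unaryOrbit_trans (b := a) ⟨0, n, rfl⟩ h

/-- The partition of the points into orbits. -/
def unaryOrbitSetoid (f : α → α) : Setoid α where
  r a b := a ∈ unaryOrbit f b
  iseqv := ⟨mem_unaryOrbit_self f, mem_unaryOrbit_symm, mem_unaryOrbit_trans⟩

theorem unaryOrbit_eq_of_mem {f : α → α} {a b : α} (h : a ∈ unaryOrbit f b) :
    unaryOrbit f a = unaryOrbit f b :=
  Set.ext fun _ => ⟨fun hx => mem_unaryOrbit_trans hx h,
    fun hx => mem_unaryOrbit_trans hx (mem_unaryOrbit_symm h)⟩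

/-- The orbits of `a` under `f` and of `b` under `g` are isomorphic. -/
def OrbitIso (f : α → α) (a : α) (g : β → β) (b : β) : Prop :=
  ∃ φ : α → β, BijOn φ (unaryOrbit f a) (unaryOrbit g b) ∧
    ∀ y ∈ unaryOrbit f a, φ (f y) = g (φ y)

theorem OrbitIso.refl (f : α → α) (a : α) : OrbitIso f a f a :=
  ⟨id, bijOn_id _, fun _ _ => rfl⟩

theorem OrbitIso.symm {f : α → α} {a : α} {g : β → β} {b : β} (h : OrbitIso f a g b) :
    OrbitIso g b f a := by
  obtain ⟨φ, hφ, hc⟩ := h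
  have : Nonempty α := ⟨a⟩
  have hinv := hφ.invOn_invFunOn
  have hb := hφ.symm hinv.symm
  refine ⟨invFunOn φ (unaryOrbit f a), hb, fun y hy => ?_⟩
  refine hφ.injOn (hb.mapsTo (apply_mem_unaryOrbit hy))
    (apply_mem_unaryOrbit (hb.mapsTo hy)) ?_
  rw [hc _ (hb.mapsTo hy), hinv.2 hy, hinv.2 (apply_mem_unaryOrbit hy)]

theorem OrbitIso.trans {f : α → α} {a : α} {g : β → β} {b : β} {h : γ → γ} {c : γ}
    (hab : OrbitIso f a g b) (hbc : OrbitIso g b h c) : OrbitIso f a h c := by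
  obtain ⟨φ, hφ, hφc⟩ := hab
  obtain ⟨ψ, hψ, hψc⟩ := hbc
  refine ⟨ψ ∘ φ, hψ.comp hφ, fun y hy => ?_⟩
  simp only [comp_apply]
  rw [hφc y hy, hψc _ (hφ.mapsTo hy)]

theorem OrbitIso.of_mem {f : α → α} {a b : α} (h : a ∈ unaryOrbit f b) : OrbitIso f a f b := by
  have := OrbitIso.refl f a
  unfold OrbitIso at *
  rwa [← unaryOrbit_eq_of_mem h]

/-- Two unary structures are isomorphic if there is a bijection between their sets of orbits that
matches isomorphic orbits. -/
theorem unaryIsomorphic_of_orbit_equiv (f : α → α) (g : β → β)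
    (E : Quotient (unaryOrbitSetoid f) ≃ Quotient (unaryOrbitSetoid g))
    (hE : ∀ q, OrbitIso f q.out g (E q).out) : UnaryIsomorphic f g := by
  choose φ hφ hc using hE
  let p : α → Quotient (unaryOrbitSetoid f) := Quotient.mk _
  have hp : ∀ {q x}, p x = q ↔ x ∈ unaryOrbit f q.out := by
    intro q x
    conv_lhs => rw [← Quotient.out_eq q]
    exact Quotient.eq (r := unaryOrbitSetoid f)
  have hp' : ∀ {q y}, (Quotient.mk (unaryOrbitSetoid g) y) = q ↔ y ∈ unaryOrbit g q.out := by
    intro q y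
    conv_lhs => rw [← Quotient.out_eq q]
    exact Quotient.eq (r := unaryOrbitSetoid g)
  have hpf : ∀ x, p (f x) = p x := fun x => hp.2 (apply_mem_unaryOrbit (hp.1 rfl))
  have hq : ∀ x, Quotient.mk (unaryOrbitSetoid g) (φ (p x) x) = E (p x) := fun x =>
    hp'.2 ((hφ (p x)).mapsTo (hp.1 rfl))
  refine ⟨Equiv.ofBijective (fun x => φ (p x) x) ⟨fun x y hxy => ?_, fun y => ?_⟩, fun x => ?_⟩
  · have hxy' : p x = p y := E.injective (by rw [← hq, ← hq]; exact congrArg _ hxy)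
    refine (hφ (p x)).injOn (hp.1 rfl) (hp.1 hxy'.symm) ?_
    exact hxy.trans (by rw [hxy'])
  · obtain ⟨q, hqy⟩ := E.surjective (Quotient.mk (unaryOrbitSetoid g) y)
    obtain ⟨x, hx, hxy⟩ := (hφ q).surjOn (hp'.1 hqy.symm)
    refine ⟨x, ?_⟩
    change φ (p x) x = y
    rw [hp.2 hx, hxy]
  · change φ (p (f x)) (f x) = g (φ (p x) x)
    rw [hpf, hc _ _ (hp.1 rfl)]

/-- Let `X` and `Y` be countable sets with colourings, and let `d` be a colour-preserving injection
that is onto the colour classes that are finite in `X`. Then there is a colour-preserving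
bijection. -/
theorem exists_equiv_of_injective_of_finite_fiber {T : Type*} [Countable α] [Countable β]
    (d : α → β) (hd : Injective d) (s : α → T) (t : β → T) (hst : ∀ x, t (d x) = s x)
    (hfin : ∀ c, {x | s x = c}.Finite → ∀ y, t y = c → y ∈ range d) :
    ∃ E : α ≃ β, ∀ x, t (E x) = s x := by
  have key : ∀ c, Nonempty ({x // s x = c} ≃ {y // t y = c}) := by
    intro c
    let d' : {x // s x = c} → {y // t y = c} := fun x => ⟨d x, by rw [hst, x.2]⟩
    have hd' : Injective d' := fun x y h => Subtype.ext (hd (congrArg Subtype.val h))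
    by_cases h : {x | s x = c}.Finite
    · refine ⟨Equiv.ofBijective d' ⟨hd', fun y => ?_⟩⟩
      obtain ⟨x, hx⟩ := hfin c h y y.2
      exact ⟨⟨x, by rw [← hst, hx, y.2]⟩, Subtype.ext hx⟩
    · have : Infinite {x // s x = c} := Set.infinite_coe_iff.2 h
      have : Infinite {y // t y = c} := Infinite.of_injective d' hd'
      exact nonempty_equiv_of_countable
  let e := fun c => (key c).some
  exact ⟨Equiv.ofFiberEquiv e, fun x => Equiv.ofFiberEquiv_map e x⟩

/-! ### Lengths -/

theorem iterate_eq_of_iterate_add_eq {f : α → α} {n L : ℕ} (h : ∀ x, f^[n + L] x = f^[n] x)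
    (x : α) (k : ℕ) : f^[n + L * k] x = f^[n] x := by
  induction k with
  | zero => rfl
  | succ k ih =>
    rw [show n + L * (k + 1) = L * k + (n + L) by ring, iterate_add_apply, h,
      ← iterate_add_apply, add_comm, ih]

theorem finite_preimage_iterate {f : α → α} (hf : ∀ a, (f ⁻¹' {a}).Finite) (n : ℕ) {s : Set α}
    (hs : s.Finite) : (f^[n] ⁻¹' s).Finite := by
  induction n with
  | zero => exact hs
  | succ n ih =>
    rw [iterate_succ, preimage_comp]
    exact ih.preimage' fun b _ => hf b

theorem finite_unaryOrbit {f : α → α} (hf : ∀ a, (f ⁻¹' {a}).Finite) {n L : ℕ} (hL : 0 < L)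
    (h : ∀ x, f^[n + L] x = f^[n] x) (a : α) : (unaryOrbit f a).Finite := by
  have hforw : ∀ m, f^[m] a ∈ (fun i => f^[i] a) '' Iio (n + L) := by
    intro m
    induction m using Nat.strong_induction_on with
    | _ m ih =>
      by_cases hm : m < n + L
      · exact ⟨m, hm, rfl⟩
      · have : f^[m] a = f^[m - L] a := by
          rw [show m = (m - (n + L)) + (n + L) by omega, iterate_add_apply, h,
            ← iterate_add_apply]
          congr 2
          omega
        rw [this]
        exact ih _ (by omega)
  refine (finite_preimage_iterate hf n ((finite_Iio (n + L)).image fun i => f^[i] a)).subset ?_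
  rintro y ⟨k, m, hkm⟩
  -- If `f^[k] y = f^[m] a`, adding the multiple `L * k ≥ k` of the period to `n` carries `y` past
  -- the meeting point, so `f^[n] y` lies on the forward path of `a`.
  have hy : f^[n] y = f^[n + L * k - k + m] a := by
    have hk : k ≤ L * k := Nat.le_mul_of_pos_left k hL
    rw [← iterate_eq_of_iterate_add_eq h y k, iterate_add_apply f (n + L * k - k) m, ← hkm,
      ← iterate_add_apply, Nat.sub_add_cancel (by omega)]
  rw [mem_preimage, hy]
  exact hforw _

theorem IsTwoZeroToOne.finite_preimage {f : α → α} (hf : IsTwoZeroToOne f) (a : α) :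
    (f ⁻¹' {a}).Finite := by
  rw [← encard_lt_top_iff]
  rcases hf a with h | h <;> rw [h] <;> decide

theorem IsTwoZeroToOne.exists_ne {f : α → α} (hf : IsTwoZeroToOne f) (a : α) :
    ∃ b, b ≠ a ∧ f b = f a := by
  rcases hf (f a) with h | h
  · exact absurd (show a ∈ f ⁻¹' {f a} from rfl) (Set.encard_eq_zero.1 h ▸ Set.notMem_empty a)
  · obtain ⟨b, hb, hba⟩ := Set.exists_ne_of_one_lt_encard (s := f ⁻¹' {f a}) (by rw [h]; decide) a
    exact ⟨b, hba, hb⟩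

theorem IsTwoZeroToOne.eq_or_eq {f : α → α} (hf : IsTwoZeroToOne f) {a b c : α}
    (hab : a ≠ b) (h : f a = f b) (hc : f c = f b) : c = a ∨ c = b := by
  rcases hf (f b) with h' | h'
  · exact absurd (show b ∈ f ⁻¹' {f b} from rfl) (Set.encard_eq_zero.1 h' ▸ Set.notMem_empty b)
  · obtain ⟨p, q, -, hpq⟩ := Set.encard_eq_two.1 h'
    have key : ∀ {z}, f z = f b → z = p ∨ z = q := fun {z} hz => by
      have : z ∈ f ⁻¹' {f b} := hz
      rwa [hpq] at this
    rcases key h with rfl | rfl <;> rcases key (z := b) rfl with rfl | rfl <;>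
      rcases key hc with rfl | rfl <;> simp_all

/-- The point `f^[n] a` has period `n - t ≤ n`, which divides `n!`; the factorial makes the period
uniform in `a`. -/
theorem iterate_add_factorial_eq {f : α → α} {n : ℕ} (h : ∀ a, ∃ t < n, f^[t] a = f^[n] a)
    (a : α) : f^[n + n.factorial] a = f^[n] a := by
  obtain ⟨t, ht, hta⟩ := h a
  obtain ⟨k, hk⟩ := Nat.dvd_factorial (show 0 < n - t by omega) (Nat.sub_le n t)
  have hp : IsPeriodicPt f (n - t) (f^[t] a) := by
    rw [IsPeriodicPt, IsFixedPt, ← iterate_add_apply, hta]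
    congr 2
    omega
  have hp' : IsPeriodicPt f (n - t) (f^[n] a) := by rwa [← hta]
  rw [add_comm, iterate_add_apply, hk]
  exact (hp'.mul_const k).eq

theorem encard_image_iterate_eq_iff {f : α → α} {a : α} {n : ℕ} :
    ((fun i => f^[i] a) '' Iic n).encard = (n : ℕ∞) + 1 ↔
      InjOn (fun i => f^[i] a) (Iic n) := by
  have hc : (Iic n).encard = (n : ℕ∞) + 1 := by
    rw [← Finset.coe_Iic, encard_coe_eq_coe_finsetCard, Nat.card_Iic]
    norm_cast
  rw [← hc]
  exact ⟨fun h => (finite_Iic n).injOn_of_encard_image_eq h, fun h => h.encard_image⟩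

theorem injOn_iterate_iff {f : α → α} {a : α} {n : ℕ} :
    InjOn (fun i => f^[i] a) (Iic n) ↔ ∀ t < n, f^[t] a ≠ f^[n] a := by
  constructor
  · intro h t ht heq
    exact ht.ne (h (mem_Iic.2 ht.le) (mem_Iic.2 le_rfl) heq)
  · intro h
    -- A coincidence at `s < t` is pushed forward by `n - t` steps to one that ends at `n`.
    have key : ∀ s t, s < t → t ≤ n → f^[s] a ≠ f^[t] a := by
      intro s t hst htn heq
      refine h (n - t + s) (by omega) ?_
      rw [iterate_add_apply, heq, ← iterate_add_apply]
      congr 2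
      omega
    intro s hs t ht heq
    rcases lt_trichotomy s t with hlt | rfl | hlt
    · exact absurd heq (key s t hlt ht)
    · rfl
    · exact absurd heq.symm (key t s hlt hs)

theorem add_one_le_pathLength {f : α → α} {a : α} {n : ℕ} (h : ∀ t < n, f^[t] a ≠ f^[n] a) :
    (n : ℕ∞) + 1 ≤ pathLength f a :=
  le_sSup ⟨n, encard_image_iterate_eq_iff.2 (injOn_iterate_iff.2 h), rfl⟩

theorem pathLength_le {f : α → α} {a : α} {n : ℕ} (h : ∃ t < n, f^[t] a = f^[n] a) :
    pathLength f a ≤ n := by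
  refine sSup_le ?_
  rintro _ ⟨m, hm, rfl⟩
  obtain ⟨t, ht, hta⟩ := h
  have hinj := encard_image_iterate_eq_iff.1 hm
  have hmn : m < n := by
    by_contra hmn
    exact ht.ne (hinj (mem_Iic.2 (by omega)) (mem_Iic.2 (by omega)) hta)
  exact_mod_cast hmn

theorem exists_iterate_eq_of_bounded {f : α → α} (hb : IsBoundedCharacter (pathCharacter f))
    (hi : ¬ HasInfiniteOrbit f) : ∃ n, ∀ a, ∃ t < n, f^[t] a = f^[n] a := by
  obtain ⟨K, hK⟩ := hb
  refine ⟨K, fun a => ?_⟩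
  by_contra! hcon
  have hK1 := add_one_le_pathLength hcon
  have hfin : (unaryOrbit f a).Finite := by
    by_contra h
    exact hi ⟨a, h⟩
  have hforw : ¬ Injective fun i : ℕ => f^[i] a := fun hinj =>
    Set.infinite_range_of_injective hinj
      (hfin.subset (range_subset_iff.2 fun i => ⟨0, i, rfl⟩))
  obtain ⟨n, hn⟩ : ∃ n, ∃ t < n, f^[t] a = f^[n] a := by
    simp only [Injective, not_forall] at hforw
    obtain ⟨s, t, hst, hne⟩ := hforw
    rcases lt_or_gt_of_ne hne with hlt | hlt
    · exact ⟨t, s, hlt, hst⟩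
    · exact ⟨s, t, hlt, hst.symm⟩
  obtain ⟨k, hk⟩ := ENat.ne_top_iff_exists.1 (ne_top_of_le_ne_top (ENat.natCast_ne_top n)
    (pathLength_le hn))
  rw [← hk] at hK1
  have hKk : K + 1 ≤ k := by exact_mod_cast hK1
  -- The length of `a` is finite because its orbit is, and it exceeds `K`; it is therefore a
  -- forbidden first coordinate.
  have := hK (k, 1) ⟨by simp only; omega, one_pos, by
    simp only [Nat.cast_one, one_le_encard_iff_nonempty]
    exact ⟨a, hk.symm⟩⟩
  simp only at this
  omega

/-- Otherwise `n` bounds every length, and the identity `f^[n + n!] = f^[n]` with finite fibres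
makes every orbit finite. -/
theorem exists_forall_iterate_ne {f : α → α} (hf : IsTwoZeroToOne f)
    (h : ¬ IsBoundedCharacter (pathCharacter f) ∨ HasInfiniteOrbit f) (n : ℕ) :
    ∃ a, ∀ t < n, f^[t] a ≠ f^[n] a := by
  by_contra! hcon
  rcases h with h | ⟨a, ha⟩
  · refine h ⟨n, ?_⟩
    rintro ⟨k, m⟩ ⟨-, hm, hkm⟩
    have : {a | pathLength f a = (k : ℕ∞)}.Nonempty := by
      rw [← one_le_encard_iff_nonempty]
      refine le_trans ?_ hkm
      exact_mod_cast hm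
    obtain ⟨a, ha⟩ := this
    have := pathLength_le (hcon a)
    rw [ha] at this
    exact_mod_cast this
  · exact ha (finite_unaryOrbit hf.finite_preimage n.factorial_pos
      (iterate_add_factorial_eq hcon) a)

/-! ### Isomorphisms and `Z`-chains -/

theorem image_unaryOrbit {f : α → α} {g : β → β} (e : α ≃ β) (he : ∀ x, e (f x) = g (e x))
    (a : α) : e '' unaryOrbit f a = unaryOrbit g (e a) := by
  have hit : ∀ n x, e (f^[n] x) = g^[n] (e x) := fun n =>
    (show Semiconj e f g from he).iterate_right n
  ext y
  constructor
  · rintro ⟨x, ⟨n, m, h⟩, rfl⟩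
    exact ⟨n, m, by rw [← hit, ← hit, h]⟩
  · rintro ⟨n, m, h⟩
    refine ⟨e.symm y, ⟨n, m, e.injective ?_⟩, e.apply_symm_apply y⟩
    rw [hit, hit, e.apply_symm_apply, h]

theorem IsZChain.image {f : α → α} {g : β → β} (e : α ≃ β) (he : ∀ x, e (f x) = g (e x))
    {O : Set α} (hO : IsZChain f O) : IsZChain g (e '' O) := by
  obtain ⟨⟨a, rfl⟩, s, hs, hfs, hsO⟩ := hO
  exact ⟨⟨e a, image_unaryOrbit e he a⟩, e ∘ s, e.injective.comp hs,
    fun i => by simp only [comp_apply]; rw [← he, hfs], fun i => mem_image_of_mem e (hsO i)⟩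

theorem finite_isZChain_of_unaryIsomorphic {f : α → α} {g : β → β} (h : UnaryIsomorphic f g)
    (hfin : {O | IsZChain f O}.Finite) : {O | IsZChain g O}.Finite := by
  obtain ⟨e, he⟩ := h
  refine (hfin.image fun O => e '' O).subset fun O hO => ⟨e.symm '' O, ?_, ?_⟩
  · refine IsZChain.image e.symm (fun x => e.injective ?_) hO
    rw [he, e.apply_symm_apply, e.apply_symm_apply]
  · exact e.image_symm_image O

end UnaryCombinatorics

/-! ### Almost all elements of a cohesive set. -/

section CohesiveFilter

open Filter

/-- The filter of the sets that almost include `C`. -/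
def almostFilter (C : Set ℕ) : Filter ℕ := cofinite ⊓ 𝓟 C

theorem eventually_almostFilter {C : Set ℕ} {p : ℕ → Prop} :
    (∀ᶠ i in almostFilter C, p i) ↔ AlmostSubset C {i | p i} := by
  rw [almostFilter, eventually_inf_principal, eventually_cofinite, AlmostSubset]
  congr! 1
  ext i
  simp

theorem IsCohesive.neBot {C : Set ℕ} (hC : IsCohesive C) : (almostFilter C).NeBot :=
  cofinite_inf_principal_neBot_iff.2 hC.1

theorem IsCohesive.eventually_or {C : Set ℕ} (hC : IsCohesive C) {p : ℕ → Prop} (hp : REPred p) :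
    (∀ᶠ i in almostFilter C, p i) ∨ ∀ᶠ i in almostFilter C, ¬ p i := by
  rw [eventually_almostFilter, eventually_almostFilter, AlmostSubset, AlmostSubset]
  rcases hC.2 {i | p i} hp with h | h
  · exact Or.inr (h.subset fun i hi => ⟨not_not.1 hi.2, hi.1⟩)
  · exact Or.inl (h.subset fun i hi => ⟨hi.2, hi.1⟩)

theorem eventually_le_almostFilter (C : Set ℕ) (n : ℕ) : ∀ᶠ i in almostFilter C, n ≤ i := by
  refine Filter.Eventually.filter_mono inf_le_left ?_
  rw [Nat.cofinite_eq_atTop]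
  exact eventually_ge_atTop n

end CohesiveFilter

theorem Computable.nat_iterate {α : Type*} [Primcodable α] {g : α → α} (hg : Computable g) :
    Computable₂ fun (n : ℕ) (a : α) => g^[n] a := by
  have : Computable fun q : ℕ × α => (Nat.rec q.2 (fun _ b => g b) q.1 : α) :=
    Computable.nat_rec Computable.fst Computable.snd
      ((hg.comp (Computable.snd.comp Computable.snd)).to₂)
  refine this.of_eq fun ⟨n, a⟩ => ?_
  change (Nat.rec a (fun _ b => g b) n : α) = g^[n] a
  induction n with
  | zero => rfl
  | succ n ih =>
    rw [Function.iterate_succ_apply', ← ih]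

/-! ### Evaluation of elements of the cohesive power. -/

namespace ComputableUnary

open Filter

variable {A : ComputableUnary} {C : Set ℕ}

/-- The value at `i` of a representative of `x`, where it is defined. -/
noncomputable def Power.val [Nonempty A.carrier] (x : A.Power C) (i : ℕ) : A.carrier :=
  open Classical in
  if h : ((Quotient.out (s := A.powerSetoid C) x).1 i).Dom then
    ((Quotient.out (s := A.powerSetoid C) x).1 i).get h
  -- The default is harmless: it is used only off the domain, hence at finitely many elements of
  -- `C`.
  else Classical.arbitrary _

section Val

variable [Nonempty A.carrier]

theorem Power.eventually_eq_some (x : A.Power C) : ∀ᶠ i in almostFilter C,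
    (Quotient.out (s := A.powerSetoid C) x).1 i = Part.some (x.val i) := by
  refine (eventually_almostFilter (p := fun i => i ∈ PFun.Dom _).2
    (Quotient.out (s := A.powerSetoid C) x).2.2).mono fun i hi => ?_
  have h : ((Quotient.out (s := A.powerSetoid C) x).1 i).Dom := hi
  rw [Power.val, dif_pos h, Part.some_get]

/-- `Power.val` involves arbitrary default values; computability arguments use this `φ` instead. -/
theorem Power.exists_partrec (x : A.Power C) : ∃ φ : ℕ →. ℕ, Partrec φ ∧
    (∀ i, ∀ n ∈ φ i, n ∈ A.carrier) ∧
    ∀ᶠ i in almostFilter C, φ i = Part.some (x.val i : ℕ) := by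
  refine ⟨_, (Quotient.out (s := A.powerSetoid C) x).2.1, fun i n hn => ?_, ?_⟩
  · obtain ⟨a, -, rfl⟩ := (Part.mem_map_iff _).1 hn
    exact a.2
  · filter_upwards [x.eventually_eq_some] with i hi
    rw [hi, Part.map_some]

theorem Power.eventually_val_mk (ψ : A.PowerElem C) : ∀ᶠ i in almostFilter C,
    Power.val (Quotient.mk (A.powerSetoid C) ψ) i ∈ ψ.1 i := by
  have h : AlmostSubset C {i | ∃ a,
      a ∈ (Quotient.out (Quotient.mk (A.powerSetoid C) ψ)).1 i ∧ a ∈ ψ.1 i} :=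
    Quotient.mk_out (s := A.powerSetoid C) ψ
  filter_upwards [eventually_almostFilter.2 h,
    Power.eventually_eq_some (Quotient.mk (A.powerSetoid C) ψ)] with i ⟨a, ha, ha'⟩ hi
  rw [hi, Part.mem_some_iff] at ha
  rwa [← ha]

theorem Power.ext {x y : A.Power C} (h : ∀ᶠ i in almostFilter C, x.val i = y.val i) : x = y := by
  refine Quotient.out_equiv_out.1 (eventually_almostFilter.1 ?_)
  filter_upwards [h, x.eventually_eq_some, y.eventually_eq_some] with i hi hx hy
  refine ⟨x.val i, ?_, ?_⟩
  · rw [hx]; exact Part.mem_some _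
  · rw [hy, hi]; exact Part.mem_some _

theorem Power.eventually_val_powerMap (x : A.Power C) : ∀ᶠ i in almostFilter C,
    (A.powerMap C x).val i = A.map (x.val i) := by
  have hx : A.powerMap C x = Quotient.mk (A.powerSetoid C)
      (A.powerElemMap C (Quotient.out (s := A.powerSetoid C) x)) := by
    conv_lhs => rw [← Quotient.out_eq (s := A.powerSetoid C) x]
    rfl
  rw [hx]
  filter_upwards [Power.eventually_val_mk
      (A.powerElemMap C (Quotient.out (s := A.powerSetoid C) x)), x.eventually_eq_some] with i h hi
  have h' : _ ∈ ((Quotient.out (s := A.powerSetoid C) x).1 i).map A.map := h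
  rwa [hi, Part.map_some, Part.mem_some_iff] at h'

theorem Power.eventually_val_iterate (x : A.Power C) (n : ℕ) : ∀ᶠ i in almostFilter C,
    ((A.powerMap C)^[n] x).val i = A.map^[n] (x.val i) := by
  induction n with
  | zero => exact Eventually.of_forall fun _ => rfl
  | succ n ih =>
    filter_upwards [ih, Power.eventually_val_powerMap ((A.powerMap C)^[n] x)] with i h h'
    rw [Function.iterate_succ_apply', Function.iterate_succ_apply', h', h]

theorem Power.exists_of_partrec {φ : ℕ →. ℕ} (hφ : Partrec φ)
    (hc : ∀ i, ∀ n ∈ φ i, n ∈ A.carrier) (hd : ∀ᶠ i in almostFilter C, (φ i).Dom) :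
    ∃ x : A.Power C, ∀ᶠ i in almostFilter C, (x.val i : ℕ) ∈ φ i := by
  let ψ : A.PowerElem C := ⟨fun i => ⟨(φ i).Dom, fun h => ⟨(φ i).get h, hc i _ (Part.get_mem h)⟩⟩,
    hφ.of_eq fun i => rfl, eventually_almostFilter.1 hd⟩
  refine ⟨Quotient.mk (A.powerSetoid C) ψ, (Power.eventually_val_mk ψ).mono fun i hi => ?_⟩
  obtain ⟨h, hi⟩ := hi
  rw [← hi]
  exact Part.get_mem (o := φ i) h

theorem Power.exists_const (C : Set ℕ) (a : A.carrier) :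
    ∃ x : A.Power C, ∀ᶠ i in almostFilter C, x.val i = a := by
  obtain ⟨x, hx⟩ := Power.exists_of_partrec (A := A) (C := C) (φ := fun _ => Part.some (a : ℕ))
    (Computable.const (a : ℕ)).partrec (fun i n hn => Part.mem_some_iff.1 hn ▸ a.2)
    (Eventually.of_forall fun _ => trivial)
  exact ⟨x, hx.mono fun i hi => Subtype.ext (Part.mem_some_iff.1 hi)⟩

/-- The number of steps may vary with `i`; such nonstandard iterates form the `Z`-chains. -/
theorem Power.exists_iterate (x : A.Power C) {p : ℕ → ℕ} (hp : Computable p) :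
    ∃ y : A.Power C, ∀ᶠ i in almostFilter C, y.val i = A.map^[p i] (x.val i) := by
  obtain ⟨φ, hφ, hc, hv⟩ := x.exists_partrec
  obtain ⟨g, hg, hgA⟩ := A.computable_map
  have hit : ∀ n (a : A.carrier), g^[n] a = A.map^[n] a := fun n a =>
    ((show Function.Semiconj Subtype.val A.map g from fun b => (hgA b).symm).iterate_right n
      a).symm
  have hφ' : Partrec fun i => (φ i).map fun n => g^[p i] n :=
    hφ.map ((Computable.nat_iterate hg).comp (hp.comp Computable.fst) Computable.snd).to₂
  obtain ⟨y, hy⟩ := Power.exists_of_partrec (A := A) (C := C) hφ' (fun i n hn => by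
    obtain ⟨a, ha, rfl⟩ := (Part.mem_map_iff _).1 hn
    rw [hit _ ⟨a, hc i a ha⟩]
    exact Subtype.coe_prop _) (hv.mono fun i hi => by rw [hi]; trivial)
  refine ⟨y, ?_⟩
  filter_upwards [hy, hv] with i hi hi'
  rw [hi', Part.map_some, Part.mem_some_iff, hit] at hi
  exact Subtype.ext hi

/-- A cohesive set decides whether a search for an element of `A` with a computable property
succeeds; where it does, its results are an element of the cohesive power. -/
theorem Power.eventually_or_exists (hC : IsCohesive C) {φ : ℕ →. ℕ} (hφ : Partrec φ) {v : ℕ → ℕ}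
    (hv : ∀ᶠ i in almostFilter C, φ i = Part.some (v i)) {R : ℕ → ℕ → Bool}
    (hR : Computable₂ R) :
    (∀ᶠ i in almostFilter C, ∀ b : A.carrier, R (v i) b = false) ∨
      ∃ x : A.Power C, ∀ᶠ i in almostFilter C, R (v i) (x.val i) = true := by
  obtain ⟨hdec, hA⟩ := A.computable_carrier
  let S : ℕ →. ℕ := fun i => (φ i).bind fun n =>
    Nat.rfind fun b => Part.some (decide (b ∈ A.carrier) && R n b)
  have hS : Partrec S := by
    refine hφ.bind (Partrec.rfind (Computable₂.partrec₂ (f := fun (q : ℕ × ℕ) (b : ℕ) =>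
      (decide (b ∈ A.carrier) && R q.2 b)) ?_)).to₂
    exact (Primrec.and.to_comp.comp (hA.comp Computable.snd)
      (hR.comp (Computable.snd.comp Computable.fst) Computable.snd)).to₂
  have hmem : ∀ {i b}, b ∈ S i → ∃ n ∈ φ i, b ∈ A.carrier ∧ R n b = true := by
    intro i b hb
    obtain ⟨n, hn, hb⟩ := Part.mem_bind_iff.1 hb
    have := Part.mem_some_iff.1 (Nat.mem_rfind.1 hb).1
    rw [eq_comm, Bool.and_eq_true, decide_eq_true_iff] at this
    exact ⟨n, hn, this⟩
  -- The domain of `S` is c.e., so `C` is almost included in it or almost disjoint from it.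
  rcases hC.eventually_or hS.dom_re with h | h
  · right
    obtain ⟨x, hx⟩ := Power.exists_of_partrec (A := A) (C := C) hS
      (fun i b hb => by obtain ⟨-, -, h, -⟩ := hmem hb; exact h) h
    refine ⟨x, ?_⟩
    filter_upwards [hx, hv] with i hi hvi
    obtain ⟨n, hn, -, h⟩ := hmem hi
    rw [hvi, Part.mem_some_iff] at hn
    rwa [← hn]
  · left
    filter_upwards [h, hv] with i hi hvi b
    by_contra hb
    rw [Bool.not_eq_false] at hb
    refine hi ?_
    change ((φ i).bind _).Dom
    rw [hvi, Part.bind_some]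
    exact Nat.rfind_dom.2 ⟨b, by rw [Part.mem_some_iff, hb, Bool.and_true]; exact (decide_eq_true b.2).symm,
      fun _ => trivial⟩

theorem Power.eventually_val_ne (hC : IsCohesive C) {x y : A.Power C} (hxy : x ≠ y) :
    ∀ᶠ i in almostFilter C, x.val i ≠ y.val i := by
  obtain ⟨φ, hφ, -, hφv⟩ := x.exists_partrec
  obtain ⟨χ, hχ, -, hχv⟩ := y.exists_partrec
  have hP : Partrec fun i => (φ i).bind fun a => (χ i).map fun b => Nat.pair a b :=
    hφ.bind (((hχ.comp Computable.fst).map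
      (Primrec₂.natPair.to_comp.comp (Computable.snd.comp Computable.fst)
        Computable.snd).to₂).to₂)
  have hv : ∀ᶠ i in almostFilter C, ((φ i).bind fun a => (χ i).map fun b => Nat.pair a b) =
      Part.some (Nat.pair (x.val i) (y.val i)) := by
    filter_upwards [hφv, hχv] with i h h'
    rw [h, h', Part.bind_some, Part.map_some]
  -- The sought element is ignored: the search succeeds exactly where the two values agree.
  have hR : Computable₂ fun (n : ℕ) (_ : ℕ) => decide (n.unpair.1 = n.unpair.2) :=
    ((Primrec.eq (α := ℕ)).decide.comp (Primrec.fst.comp (Primrec.unpair.comp Primrec.fst))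
      (Primrec.snd.comp (Primrec.unpair.comp Primrec.fst))).to_comp.to₂
  rcases Power.eventually_or_exists (A := A) hC hP hv hR with h | ⟨z, h⟩
  · filter_upwards [h] with i hi heq
    have := hi (Classical.arbitrary _)
    rw [Nat.unpair_pair, decide_eq_false_iff_not] at this
    exact this (congrArg Subtype.val heq)
  · refine absurd (Power.ext (h.mono fun i hi => ?_)) hxy
    rw [Nat.unpair_pair, decide_eq_true_iff] at hi
    exact Subtype.ext hi

theorem Power.eventually_forall_map_ne (hC : IsCohesive C) {x : A.Power C}
    (hx : ∀ y, A.powerMap C y ≠ x) :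
    ∀ᶠ i in almostFilter C, ∀ b, A.map b ≠ x.val i := by
  obtain ⟨φ, hφ, -, hφv⟩ := x.exists_partrec
  obtain ⟨g, hg, hgA⟩ := A.computable_map
  have hR : Computable₂ fun (n : ℕ) (b : ℕ) => decide (g b = n) :=
    ((Primrec.eq (α := ℕ)).decide.to_comp.comp (hg.comp Computable.snd) Computable.fst).to₂
  rcases Power.eventually_or_exists (A := A) hC hφ hφv hR with h | ⟨z, h⟩
  · filter_upwards [h] with i hi b hb
    have := hi b
    rw [hgA, hb] at this
    simp at this
  · refine absurd (Power.ext ?_) (hx z)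
    filter_upwards [h, z.eventually_val_powerMap] with i hi hzi
    rw [decide_eq_true_iff, hgA] at hi
    rw [hzi]
    exact Subtype.ext hi

theorem Power.exists_ne_powerMap_eq (hC : IsCohesive C) (hA : IsTwoZeroToOne A.map)
    (x : A.Power C) : ∃ y, y ≠ x ∧ A.powerMap C y = A.powerMap C x := by
  have := hC.neBot
  obtain ⟨φ, hφ, -, hφv⟩ := x.exists_partrec
  obtain ⟨g, hg, hgA⟩ := A.computable_map
  have heq := (Primrec.eq (α := ℕ)).decide.to_comp
  have hR : Computable₂ fun (n : ℕ) (b : ℕ) => !decide (b = n) && decide (g b = g n) :=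
    (Primrec.and.to_comp.comp
      (Primrec.not.to_comp.comp (heq.comp Computable.snd Computable.fst))
      (heq.comp (hg.comp Computable.snd) (hg.comp Computable.fst))).to₂
  rcases Power.eventually_or_exists (A := A) hC hφ hφv hR with h | ⟨z, h⟩
  · obtain ⟨i, hi⟩ := h.exists
    obtain ⟨b, hb, hba⟩ := hA.exists_ne (x.val i)
    have := hi b
    rw [hgA, hgA, hba] at this
    simp [Subtype.ext_iff] at this hb
    exact absurd this hb
  · have h' : ∀ᶠ i in almostFilter C, z.val i ≠ x.val i ∧ A.map (z.val i) = A.map (x.val i) :=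
      h.mono fun i hi => by
        rw [hgA, hgA] at hi
        simpa [Subtype.ext_iff] using hi
    refine ⟨z, ?_, Power.ext ?_⟩
    · rintro rfl
      obtain ⟨i, hi⟩ := h'.exists
      exact hi.1 rfl
    · filter_upwards [h', z.eventually_val_powerMap, x.eventually_val_powerMap] with i hi hz hx
      rw [hz, hx, hi.2]

/-- A third preimage would, at some `i`, give three distinct preimages in `A`. -/
theorem finite_preimage_powerMap (hC : IsCohesive C) (hA : IsTwoZeroToOne A.map)
    (x : A.Power C) : (A.powerMap C ⁻¹' {x}).Finite := by
  have := hC.neBot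
  by_cases h : ∃ y, A.powerMap C y = x
  · obtain ⟨y, rfl⟩ := h
    obtain ⟨z, hzy, hz⟩ := Power.exists_ne_powerMap_eq hC hA y
    refine (Set.toFinite {z, y}).subset fun w (hw : A.powerMap C w = _) => ?_
    by_contra hcon
    rw [Set.mem_insert_iff, Set.mem_singleton_iff, not_or] at hcon
    have hzi := z.eventually_val_powerMap
    have hwi := w.eventually_val_powerMap
    rw [hz] at hzi
    rw [hw] at hwi
    obtain ⟨i, h1, h2, h3, h4, h5, h6⟩ := ((Power.eventually_val_ne hC hzy).and
      ((Power.eventually_val_ne hC hcon.1).and ((Power.eventually_val_ne hC hcon.2).and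
      (hzi.and (hwi.and y.eventually_val_powerMap))))).exists
    rcases hA.eq_or_eq h1 (h4.symm.trans h6) (h5.symm.trans h6) with h | h
    · exact h2 h
    · exact h3 h
  · convert Set.finite_empty
    rw [Set.eq_empty_iff_forall_notMem]
    exact fun y hy => h ⟨y, hy⟩

end Val

instance countable_powerElem : Countable (A.PowerElem C) := by
  let F : A.PowerElem C → {f : ℕ →. ℕ // Partrec f} := fun ψ => ⟨_, ψ.2.1⟩
  refine Function.Injective.countable (f := F) fun ψ χ h => Subtype.ext (funext fun i => ?_)
  have h' : (ψ.1 i).map Subtype.val = (χ.1 i).map Subtype.val :=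
    congrFun (congrArg Subtype.val h) i
  refine Part.ext fun a => ?_
  have key : ∀ p : Part A.carrier, a ∈ p ↔ (a : ℕ) ∈ p.map Subtype.val := fun p => by
    rw [Part.mem_map_iff]
    exact ⟨fun h => ⟨a, h, rfl⟩, fun ⟨b, hb, hab⟩ => Subtype.ext hab ▸ hb⟩
  rw [key, key, h']

instance countable_power : Countable (A.Power C) :=
  inferInstanceAs (Countable (Quotient (A.powerSetoid C)))

end ComputableUnary

/-! ### Transfer of finite orbits and construction of `Z`-chains. -/

namespace ComputableUnary

open Filter Set

variable {A : ComputableUnary} {C : Set ℕ}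

section Orbits

variable [Nonempty A.carrier]

/-- Finiteness of the orbit lets one `i` serve all its points at once: there evaluation commutes
with the maps, is injective, and creates no new preimages. -/
theorem Power.eventually_orbitIso (hC : IsCohesive C) (hA : IsTwoZeroToOne A.map) (x : A.Power C)
    (hfin : (unaryOrbit (A.powerMap C) x).Finite) : ∀ᶠ i in almostFilter C,
      OrbitIso (A.powerMap C) x A.map (x.val i) := by
  have h1 : ∀ᶠ i in almostFilter C, ∀ y ∈ unaryOrbit (A.powerMap C) x,
      (A.powerMap C y).val i = A.map (y.val i) :=
    (eventually_all_finite hfin).2 fun y _ => y.eventually_val_powerMap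
  have h2 : ∀ᶠ i in almostFilter C, ∀ y ∈ unaryOrbit (A.powerMap C) x,
      ∀ z ∈ unaryOrbit (A.powerMap C) x, y ≠ z → y.val i ≠ z.val i :=
    (eventually_all_finite hfin).2 fun y _ => (eventually_all_finite hfin).2 fun z _ =>
      eventually_imp_distrib_left.2 fun hyz => Power.eventually_val_ne hC hyz
  have h3 : ∀ᶠ i in almostFilter C, ∀ y ∈ unaryOrbit (A.powerMap C) x,
      (∀ z, A.powerMap C z ≠ y) → ∀ b, A.map b ≠ y.val i :=
    (eventually_all_finite hfin).2 fun y _ =>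
      eventually_imp_distrib_left.2 fun hy => Power.eventually_forall_map_ne hC hy
  filter_upwards [h1, h2, h3] with i h1 h2 h3
  have hit : ∀ n, ∀ y ∈ unaryOrbit (A.powerMap C) x,
      ((A.powerMap C)^[n] y).val i = A.map^[n] (y.val i) := by
    intro n y hy
    induction n with
    | zero => rfl
    | succ n ih =>
      rw [Function.iterate_succ_apply', Function.iterate_succ_apply',
        h1 _ (iterate_mem_unaryOrbit hy n), ih]
  have hx := mem_unaryOrbit_self (A.powerMap C) x
  refine ⟨fun y => y.val i, ⟨?_, ?_, ?_⟩, h1⟩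
  · rintro y ⟨n, m, h⟩
    exact ⟨n, m, by rw [← hit n y ⟨n, m, h⟩, h, hit m x hx]⟩
  · intro y hy z hz hyz
    by_contra hne
    exact h2 y hy z hz hne hyz
  -- The image is closed under preimages: a value either has none, or its two preimages are the
  -- values of `z` and its sibling `w`.
  · have hpre : ∀ c, A.map c ∈ (fun y : A.Power C => y.val i) '' unaryOrbit (A.powerMap C) x →
        c ∈ (fun y : A.Power C => y.val i) '' unaryOrbit (A.powerMap C) x := by
      rintro c ⟨y, hy, hyc⟩
      simp only at hyc
      by_cases hex : ∃ z, A.powerMap C z = y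
      · obtain ⟨z, rfl⟩ := hex
        obtain ⟨w, hwz, hw⟩ := Power.exists_ne_powerMap_eq hC hA z
        have hz := mem_unaryOrbit_of_apply hy
        have hw' : w ∈ unaryOrbit (A.powerMap C) x := mem_unaryOrbit_of_apply (hw ▸ hy)
        rcases hA.eq_or_eq (c := c) (h2 w hw' z hz hwz)
          (by rw [← h1 w hw', ← h1 z hz, hw]) (by rw [← h1 z hz, hyc]) with h | h
        · exact ⟨w, hw', h.symm⟩
        · exact ⟨z, hz, h.symm⟩
      · exact absurd hyc.symm (h3 y hy (fun z hz => hex ⟨z, hz⟩) c)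
    rintro b ⟨n, m, hb⟩
    have hb' : A.map^[n] b ∈
        (fun y : A.Power C => y.val i) '' unaryOrbit (A.powerMap C) x := by
      rw [hb, ← hit m x hx]
      exact mem_image_of_mem _ (iterate_mem_unaryOrbit hx m)
    clear hb
    induction n with
    | zero => exact hb'
    | succ n ih =>
      rw [Function.iterate_succ_apply'] at hb'
      exact ih (hpre _ hb')

theorem unaryIsomorphic_powerMap_of_iterate (hC : IsCohesive C) (hA : IsTwoZeroToOne A.map) {n : ℕ}
    (hn : ∀ a, ∃ t < n, A.map^[t] a = A.map^[n] a) :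
    UnaryIsomorphic (A.powerMap C) A.map := by
  have := hC.neBot
  have hfinA : ∀ a, (unaryOrbit A.map a).Finite :=
    finite_unaryOrbit hA.finite_preimage n.factorial_pos (iterate_add_factorial_eq hn)
  have hfinP : ∀ x, (unaryOrbit (A.powerMap C) x).Finite := by
    refine finite_unaryOrbit (n := n) (finite_preimage_powerMap hC hA) n.factorial_pos fun x => Power.ext ?_
    filter_upwards [x.eventually_val_iterate (n + n.factorial), x.eventually_val_iterate n]
      with i h h'
    rw [h, h', iterate_add_factorial_eq hn]
  have hiso := fun x => Power.eventually_orbitIso hC hA x (hfinP x)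
  choose d hd using Power.exists_const (A := A) C
  have hdiso : ∀ a, OrbitIso (A.powerMap C) (d a) A.map a := by
    intro a
    obtain ⟨i, hi, hi'⟩ := ((hiso (d a)).and (hd a)).exists
    rwa [hi'] at hi
  have hdmap : ∀ k a, ∀ᶠ i in almostFilter C,
      ((A.powerMap C)^[k] (d a)).val i = A.map^[k] a := by
    intro k a
    filter_upwards [hd a, (d a).eventually_val_iterate k] with i h h'
    rw [h', h]
  have hdorbit : ∀ a b, d a ∈ unaryOrbit (A.powerMap C) (d b) ↔ a ∈ unaryOrbit A.map b := by
    intro a b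
    refine exists_congr fun k => exists_congr fun l => ⟨fun h => ?_, fun h => Power.ext ?_⟩
    · obtain ⟨i, hi, hi'⟩ := ((hdmap k a).and (hdmap l b)).exists
      rw [← hi, ← hi', h]
    · filter_upwards [hdmap k a, hdmap l b] with i hi hi'
      rw [hi, hi', h]
  let D : Quotient (unaryOrbitSetoid A.map) → Quotient (unaryOrbitSetoid (A.powerMap C)) :=
    Quotient.map d fun a b h => (hdorbit a b).2 h
  have hD : Function.Injective D := by
    rintro ⟨a⟩ ⟨b⟩ h
    exact Quotient.sound ((hdorbit a b).1 (Quotient.exact h))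
  -- The colour of an orbit, in either structure, is the set of points of `A` whose orbits are
  -- isomorphic to it.
  let s : Quotient (unaryOrbitSetoid A.map) → Set A.carrier :=
    fun q => {b | OrbitIso A.map q.out A.map b}
  let t : Quotient (unaryOrbitSetoid (A.powerMap C)) → Set A.carrier :=
    fun q => {b | OrbitIso (A.powerMap C) q.out A.map b}
  have hs : ∀ a, s (Quotient.mk _ a) = {b | OrbitIso A.map a A.map b} := by
    intro a
    have : OrbitIso A.map (Quotient.mk (unaryOrbitSetoid A.map) a).out A.map a :=
      .of_mem (Quotient.mk_out (s := unaryOrbitSetoid A.map) a)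
    exact Set.ext fun b => ⟨fun h => this.symm.trans h, fun h => this.trans h⟩
  have ht : ∀ x, t (Quotient.mk _ x) = {b | OrbitIso (A.powerMap C) x A.map b} := by
    intro x
    have : OrbitIso (A.powerMap C) (Quotient.mk (unaryOrbitSetoid (A.powerMap C)) x).out
        (A.powerMap C) x := .of_mem (Quotient.mk_out (s := unaryOrbitSetoid (A.powerMap C)) x)
    exact Set.ext fun b => ⟨fun h => this.symm.trans h, fun h => this.trans h⟩
  obtain ⟨E, hE⟩ := exists_equiv_of_injective_of_finite_fiber D hD s t
    (by
      rintro ⟨a⟩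
      refine (ht (d a)).trans (Eq.trans ?_ (hs a).symm)
      exact Set.ext fun b => ⟨fun h => (hdiso a).symm.trans h, fun h => (hdiso a).trans h⟩)
    (by
      rintro c hc ⟨x⟩ hx
      replace hx : {b | OrbitIso (A.powerMap C) x A.map b} = c := (ht x).symm.trans hx
      -- Finitely many orbits, each finite, contain finitely many points.
      have hfin : {a | s (Quotient.mk _ a) = c}.Finite := by
        refine hc.preimage' (f := Quotient.mk (unaryOrbitSetoid A.map)) fun q _ => ?_
        refine (hfinA q.out).subset fun a ha => ?_
        rw [mem_preimage, mem_singleton_iff] at ha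
        rw [← ha]
        exact Quotient.exact (s := unaryOrbitSetoid A.map) (Quotient.out_eq _).symm
      have hmem : ∀ᶠ i in almostFilter C, x.val i ∈ {a | s (Quotient.mk _ a) = c} := by
        filter_upwards [hiso x] with i hi
        rw [hs, ← hx]
        exact Set.ext fun b => ⟨fun h => hi.trans h, fun h => hi.symm.trans h⟩
      by_contra hcon
      -- If `x` were none of the constants from this finite set, its values would almost always
      -- avoid the set, against `hmem`.
      have hne : ∀ᶠ i in almostFilter C, ∀ a ∈ {a | s (Quotient.mk _ a) = c},
          x.val i ≠ a := by
        refine (eventually_all_finite hfin).2 fun a _ => ?_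
        have hxa : x ≠ d a := by
          rintro rfl
          exact hcon ⟨Quotient.mk _ a, rfl⟩
        filter_upwards [Power.eventually_val_ne hC hxa, hd a] with i h h'
        rwa [← h']
      obtain ⟨i, hi, hi'⟩ := (hmem.and hne).exists
      exact hi' _ hi rfl)
  refine unaryIsomorphic_of_orbit_equiv _ _ E.symm fun q => ?_
  have h := hE (E.symm q)
  rw [E.apply_symm_apply] at h
  -- The colour of an orbit of `A` contains its own representative, so equal colours give isomorphic
  -- orbits.
  have : (E.symm q).out ∈ s (E.symm q) := OrbitIso.refl _ _
  rw [← h] at this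
  exact this

/-- Being non-repeating for `N i` steps is decidable, and the search for such a point succeeds at
every `i`. -/
theorem Power.exists_eventually_iterate_ne (hC : IsCohesive C)
    (h : ∀ n, ∃ a, ∀ t < n, A.map^[t] a ≠ A.map^[n] a) {N : ℕ → ℕ} (hN : Computable N) :
    ∃ x : A.Power C, ∀ᶠ i in almostFilter C,
      ∀ t < N i, A.map^[t] (x.val i) ≠ A.map^[N i] (x.val i) := by
  have := hC.neBot
  obtain ⟨g, hg, hgA⟩ := A.computable_map
  have hit : ∀ n (a : A.carrier), g^[n] a = A.map^[n] a := fun n a =>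
    ((show Function.Semiconj Subtype.val A.map g from fun b => (hgA b).symm).iterate_right n
      a).symm
  let R : ℕ → ℕ → Bool := fun i b =>
    Nat.rec true (fun t r => r && !decide (g^[t] b = g^[N i] b)) (N i)
  have hR : Computable₂ R := by
    have hgi := Computable.nat_iterate hg
    have hb : Computable fun q : (ℕ × ℕ) × (ℕ × Bool) => q.1.2 :=
      Computable.snd.comp Computable.fst
    exact Computable.nat_rec (hN.comp Computable.fst) (Computable.const true)
      (Primrec.and.to_comp.comp (Computable.snd.comp Computable.snd)
      (Primrec.not.to_comp.comp ((Primrec.eq (α := ℕ)).decide.to_comp.comp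
        (hgi.comp (Computable.fst.comp Computable.snd) hb)
        (hgi.comp (hN.comp (Computable.fst.comp Computable.fst)) hb)))).to₂
  have hRiff : ∀ i (b : A.carrier),
      R i b = true ↔ ∀ t < N i, A.map^[t] b ≠ A.map^[N i] b := by
    intro i b
    have key : ∀ m, (Nat.rec true (fun t r => r && !decide (g^[t] b = g^[N i] b)) m : Bool) = true ↔
        ∀ t < m, A.map^[t] b ≠ A.map^[N i] b := by
      intro m
      induction m with
      | zero => simp
      | succ m ih =>
        rw [Bool.and_eq_true, ih, Bool.not_eq_true', decide_eq_false_iff_not, hit, hit,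
          ← Subtype.ext_iff]
        exact Nat.forall_lt_succ_right.symm
    exact key (N i)
  rcases Power.eventually_or_exists (A := A) hC (φ := fun i => Part.some i) Computable.id.partrec
    (v := id) (Eventually.of_forall fun _ => rfl) hR with hf | ⟨x, hx⟩
  · obtain ⟨i, hi⟩ := hf.exists
    obtain ⟨a, ha⟩ := h (N i)
    exact absurd ((hRiff i a).2 ha) (by rw [show R i a = false from hi a]; decide)
  · exact ⟨x, hx.mono fun i hi => (hRiff i _).1 hi⟩

theorem infinite_setOf_isZChain_powerMap (hC : IsCohesive C)
    (h : ∀ n, ∃ a, ∀ t < n, A.map^[t] a ≠ A.map^[n] a) :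
    {O : Set (A.Power C) | IsZChain (A.powerMap C) O}.Infinite := by
  have := hC.neBot
  -- The quadratic length eventually exceeds every `(j + 1) * i + k`.
  obtain ⟨x, hx⟩ := Power.exists_eventually_iterate_ne (C := C) hC h (N := fun i => i * i)
    (Primrec.nat_mul.comp Primrec.id Primrec.id).to_comp
  -- The coefficient `j + 1` is positive, so `toNat` truncates at only finitely many `i`, even for
  -- negative `k`.
  let p : ℕ → ℤ → ℕ → ℕ := fun j k i => (((j + 1) * i : ℕ) + k).toNat
  have hp : ∀ j k, Computable (p j k) := by
    intro j k
    have hm : Primrec fun i => (j + 1) * i := Primrec.nat_mul.comp (Primrec.const _) Primrec.id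
    obtain ⟨m, rfl | rfl⟩ := k.eq_nat_or_neg
    · refine (Primrec.nat_add.comp hm (Primrec.const m)).to_comp.of_eq fun i => ?_
      simp only [p]
      omega
    · refine (Primrec.nat_sub.comp hm (Primrec.const m)).to_comp.of_eq fun i => ?_
      simp only [p]
      omega
  choose s hs using fun j k => x.exists_iterate (hp j k)
  have hle : ∀ j (k : ℤ) (i : ℕ), j + 2 + k.natAbs ≤ i →
      (p j k i : ℤ) = (j + 1) * i + k ∧ p j k i ≤ i * i := by
    intro j k i hi
    have h1 : (j + 1) * i + k.natAbs ≤ i * i := by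
      nlinarith [Nat.mul_le_mul_right i hi, Nat.zero_le (k.natAbs * i), Nat.zero_le (j * i)]
    have h2 : i ≤ (j + 1) * i := Nat.le_mul_of_pos_left _ j.succ_pos
    have h3 : (((j + 1) * i : ℕ) : ℤ) = (j + 1) * i := by push_cast; ring
    simp only [p]
    rw [← h3]
    omega
  have hsucc : ∀ j k, A.powerMap C (s j k) = s j (k + 1) := by
    intro j k
    refine Power.ext ?_
    filter_upwards [hs j k, hs j (k + 1), (s j k).eventually_val_powerMap,
      eventually_le_almostFilter C (j + 2 + k.natAbs),
      eventually_le_almostFilter C (j + 2 + (k + 1).natAbs)] with i h1 h2 h3 h4 h5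
    have hpp : p j (k + 1) i = p j k i + 1 := by
      have := (hle j k i h4).1
      have := (hle j (k + 1) i h5).1
      omega
    rw [h3, h1, h2, hpp, Function.iterate_succ_apply']
  have hit : ∀ j k (n : ℕ), (A.powerMap C)^[n] (s j k) = s j (k + n) := by
    intro j k n
    induction n with
    | zero => simp
    | succ n ih =>
      rw [Function.iterate_succ_apply', ih, hsucc]
      push_cast
      rw [add_assoc]
  have hinj : ∀ j k j' k', s j k = s j' k' → j = j' ∧ k = k' := by
    intro j k j' k' heq
    have hev : ∀ᶠ i : ℕ in almostFilter C,
        ((j : ℤ) + 1) * i + k = ((j' : ℤ) + 1) * i + k' := by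
      filter_upwards [hs j k, hs j' k', hx,
        eventually_le_almostFilter C (j + 2 + k.natAbs),
        eventually_le_almostFilter C (j' + 2 + k'.natAbs)] with i h1 h2 h3 h4 h5
      obtain ⟨h6, h7⟩ := hle j k i h4
      obtain ⟨h8, h9⟩ := hle j' k' i h5
      rw [heq, h2] at h1
      rw [← h6, ← h8, injOn_iterate_iff.2 h3 (mem_Iic.2 h9) (mem_Iic.2 h7) h1]
    -- Two linear functions of `i` that agree at two arguments coincide.
    obtain ⟨i, hi⟩ := hev.exists
    obtain ⟨i', hi', hlt⟩ := (hev.and (eventually_le_almostFilter C (i + 1))).exists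
    have hlt' : (0 : ℤ) < i' - i := by omega
    have h0 : ((j : ℤ) - j') * (i' - i) = 0 := by linear_combination hi' - hi
    have hj : j = j' := by
      rcases mul_eq_zero.1 h0 with h | h
      · omega
      · omega
    subst hj
    exact ⟨rfl, by linarith⟩
  refine Set.infinite_of_injective_forall_mem (f := fun j => unaryOrbit (A.powerMap C) (s j 0))
    (fun j j' hjj => ?_) fun j => ⟨⟨_, rfl⟩, s j, fun k l hkl => (hinj j k j l hkl).2, fun k =>
      hsucc j k, fun k => ⟨(-k).toNat, k.toNat, ?_⟩⟩
  · have hmem : s j 0 ∈ unaryOrbit (A.powerMap C) (s j' 0) := by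
      simp only at hjj
      rw [← hjj]
      exact mem_unaryOrbit_self _ _
    obtain ⟨n, m, hnm⟩ := hmem
    rw [hit, hit] at hnm
    exact (hinj _ _ _ _ hnm).1
  · rw [hit, hit]
    congr 1
    omega

end Orbits

theorem isEmpty_power (hC : IsCohesive C) [IsEmpty A.carrier] : IsEmpty (A.Power C) := by
  refine ⟨fun x => Quotient.inductionOn (s := A.powerSetoid C) x fun ψ => ?_⟩
  have := hC.neBot
  obtain ⟨i, hi⟩ := ((eventually_almostFilter (p := fun i => i ∈ PFun.Dom ψ.1)).2 ψ.2.2).exists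
  exact isEmptyElim ((ψ.1 i).get hi)

end ComputableUnary

theorem mainTheorem4 (C : Set ℕ) (hC : IsCohesive C) (A : ComputableUnary)
    (hA : IsTwoZeroToOne A.map) :
    (IsBoundedCharacter (pathCharacter A.map) ∧ ¬ HasInfiniteOrbit A.map →
      UnaryIsomorphic (A.powerMap C) A.map) ∧
    (¬ IsBoundedCharacter (pathCharacter A.map) ∨ HasInfiniteOrbit A.map →
      {O : Set (A.Power C) | IsZChain (A.powerMap C) O}.Infinite ∧
      ({O : Set A.carrier | IsZChain A.map O}.Finite →
        ¬ UnaryIsomorphic A.map (A.powerMap C))) := by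
  refine ⟨fun ⟨hb, hi⟩ => ?_, fun h => ?_⟩
  -- The empty structure is separate because `Power.val` needs a default point.
  · rcases isEmpty_or_nonempty A.carrier with he | hne
    · have := ComputableUnary.isEmpty_power (A := A) hC
      exact ⟨Equiv.equivOfIsEmpty _ _, isEmptyElim⟩
    · obtain ⟨n, hn⟩ := exists_iterate_eq_of_bounded hb hi
      exact ComputableUnary.unaryIsomorphic_powerMap_of_iterate hC hA hn
  · have hne := exists_forall_iterate_ne hA h
    have : Nonempty A.carrier := ⟨(hne 0).choose⟩
    have hinf := ComputableUnary.infinite_setOf_isZChain_powerMap hC hne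
    exact ⟨hinf, fun hfin hiso => hinf (finite_isZChain_of_unaryIsomorphic hiso hfin)⟩
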